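/- Let $\mathcal B$ be a unital C$^*$-algebra and let $a\in\mathcal B$ be self-adjoint. A $\mathcal B$-valued C$^*$-probability space is an inclusion $\mathcal B\subseteq\mathcal A$ of unital C$^*$-algebras with a positive conditional expectation $E:\mathcal A\to\mathcal B$; the distribution of a self-adjoint $X\in\mathcal A$ is the map $\mu_X:\mathcal B\langle\mathcal X\rangle\to\mathcal B$, $\mu_X(f)=E(f(X))$, on noncommutative polynomials in $\mathcal X$ with coefficients in $\mathcal B$. A sequence $(X_i)_{i\ge1}$ in $\mathcal A$ is monotone independent over $\mathcal B$ if $$E(A_1\cdots A_{j-1}A_jA_{j+1}\cdots A_n)=E(A_1\cdots A_{j-1}E(A_j)A_{j+1}\cdots A_n)$$ whenever each $A_l$ is the value at $X_{\epsilon(l)}$ of a polynomial without free term, $\epsilon(l)\ne\epsilon(l+1)$ for all $l$, and $\epsilon(j)$ is larger than those of $\epsilon(j-1)$, $\epsilon(j+1)$ that exist. The $\mathcal B$-valued arcsine law $\mathfrak a$ of variance $\eta:\mathcal B\to\mathcal B$ is the monotone central limit law: the limit, pointwise on $\mathcal B\langle\mathcal X\rangle$ in the norm of $\mathcal B$, of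 the distributions of $(X_1+\cdots+X_N)/\sqrt N$, where the $X_i$ are centered ($E(X_i)=0$), identically distributed, monotone independent self-adjoint elements of a $\mathcal B$-valued C$^*$-probability space with $E(X_ibX_i)=\eta(b)$ for all $b\in\mathcal B$. Let $\mathbb H^+(\mathcal B)$ be the set of $b\in\mathcal B$ such that $(b-b^*)/2i$ is positive and invertible. The Cauchy transform of $\mathfrak a$ is $G_{\mathfrak a}(b)=E\big((b-X)^{-1}\big)$, $b\in\mathbb H^+(\mathcal B)$, where $X$ is a self-adjoint element of a $\mathcal B$-valued C$^*$-probability space with distribution $\mathfrak a$. If $\mathfrak a$ is the arcsine law of variance $\eta(b)=aba$, then $$\big(b\,G_{\mathfrak a}(b)\big)^2=1+2\,\big(a\,G_{\mathfrak a}(b)\big)^2\qquad\text{for all } b\in\mathbb H^+(\mathcal B).$$ If $\mathfrak a$ is the arcsine law of variance $\eta(b)=2aba$, then $$\big(b\,G_{\mathfrak a}(b)\big)^2=1+4\,\big(a\,G_{\mathfrak a}(b)\big)^2\qquad\text{for all } b\in\mathbb H^+(\mathcal B).$$ -/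

import Mathlib

open scoped Topology ComplexStarModule

/-- The relations saying that the generators `some b` multiply and add as the elements `b` of the
unital complex algebra `B` do; the generator `none` (the indeterminate) satisfies no relation. -/
inductive NCPolyRel (B : Type*) [Ring B] [Algebra ℂ B] :
    FreeAlgebra ℂ (Option B) → FreeAlgebra ℂ (Option B) → Prop
  | add (b c : B) : NCPolyRel B (FreeAlgebra.ι ℂ (some (b + c)))
      (FreeAlgebra.ι ℂ (some b) + FreeAlgebra.ι ℂ (some c))
  | mul (b c : B) : NCPolyRel B (FreeAlgebra.ι ℂ (some (b * c)))
      (FreeAlgebra.ι ℂ (some b) * FreeAlgebra.ι ℂ (some c))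
  | scalar (z : ℂ) : NCPolyRel B (FreeAlgebra.ι ℂ (some (algebraMap ℂ B z)))
      (algebraMap ℂ (FreeAlgebra ℂ (Option B)) z)

/-- `B⟨X⟩`: the algebra freely generated by `B` and a symbol `X`, that is, the noncommutative
polynomials in `X` with coefficients in `B`. -/
abbrev NCPoly (B : Type*) [Ring B] [Algebra ℂ B] : Type _ := RingQuot (NCPolyRel B)

namespace NCPoly

variable {B : Type*} [Ring B] [Algebra ℂ B]

/-- The indeterminate of `B⟨X⟩`. -/
noncomputable def X : NCPoly B :=
  RingQuot.mkAlgHom ℂ (NCPolyRel B) (FreeAlgebra.ι ℂ none)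

/-- An element of `B` as a constant polynomial. -/
noncomputable def C (b : B) : NCPoly B :=
  RingQuot.mkAlgHom ℂ (NCPolyRel B) (FreeAlgebra.ι ℂ (some b))

/-- `B⟨X⟩₀`: the polynomials without free term, that is, the linear combinations of products
with at least one factor `X`. -/
def noFreeTerm (B : Type*) [Ring B] [Algebra ℂ B] : Submodule ℂ (NCPoly B) :=
  Submodule.span ℂ {p | ∃ f g : NCPoly B, p = f * X * g}

/-- Evaluation `f(X) ↦ f(x)` at an element `x` of an algebra `A` to which `B` maps. -/
noncomputable def eval {A : Type*} [Ring A] [Algebra ℂ A] (j : B →ₐ[ℂ] A) (x : A) :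
    NCPoly B →ₐ[ℂ] A :=
  RingQuot.liftAlgHom ℂ
    ⟨FreeAlgebra.lift ℂ (fun o : Option B => o.elim x j), by
      intro p q h
      cases h <;> simp⟩

theorem eval_X {A : Type*} [Ring A] [Algebra ℂ A] (j : B →ₐ[ℂ] A) (x : A) :
    eval j x X = x := by
  simp [eval, X]

theorem eval_C {A : Type*} [Ring A] [Algebra ℂ A] (j : B →ₐ[ℂ] A) (x : A) (b : B) :
    eval j x (C b) = j b := by
  simp [eval, C]

end NCPoly

/-- A `B`-valued noncommutative C*-probability space: an inclusion `B ⊆ A` of unital C*-algebras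
with a positive conditional expectation `E : A → B`. (The map `incl` is injective by `E_incl`.) -/
structure CStarProbSpace (B A : Type*) [CStarAlgebra B] [PartialOrder B] [StarOrderedRing B]
    [CStarAlgebra A] where
  incl : B →⋆ₐ[ℂ] A
  E : A →ₗ[ℂ] B
  E_incl : ∀ b : B, E (incl b) = b
  E_bimodule : ∀ (b : B) (x : A) (c : B), E (incl b * x * incl c) = b * E x * c
  E_nonneg : ∀ x : A, 0 ≤ E (star x * x)

namespace CStarProbSpace

variable {B A : Type*} [CStarAlgebra B] [PartialOrder B] [StarOrderedRing B] [CStarAlgebra A]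
  (P : CStarProbSpace B A)

/-- Evaluation of the polynomials of `B⟨X⟩` at `x ∈ A`. -/
noncomputable def eval (x : A) : NCPoly B →ₐ[ℂ] A :=
  NCPoly.eval (P.incl : B →ₐ[ℂ] A) x

/-- The distribution `μ_x : B⟨X⟩ → B` of `x`, given by `f(X) ↦ E (f(x))`. -/
noncomputable def law (x : A) : NCPoly B →ₗ[ℂ] B :=
  P.E ∘ₗ (P.eval x).toLinearMap

/-- `B⟨x⟩₀`: the values at `x` of the polynomials without free term. -/
noncomputable def noFreeTerm (x : A) : Submodule ℂ A :=
  (NCPoly.noFreeTerm B).map (P.eval x).toLinearMap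

/-- Monotone independence over `B` of a family indexed by a totally ordered set:
`E (A₁ ⋯ Aⱼ₋₁ Aⱼ Aⱼ₊₁ ⋯ Aₙ) = E (A₁ ⋯ Aⱼ₋₁ E(Aⱼ) Aⱼ₊₁ ⋯ Aₙ)` whenever each `Aₗ` lies in
`B⟨X (ε l)⟩₀`, consecutive indices `ε l` differ, and `ε j` is larger than the neighbouring
indices (those that exist). Here `L` lists the pairs `(ε l, Aₗ)` with `l < j`,
and `R` those with `l > j`. -/
def MonotoneIndep {ι : Type*} [LinearOrder ι] (X : ι → A) : Prop :=
  ∀ (L R : List (ι × A)) (i : ι) (y : A),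
    (∀ p ∈ L ++ (i, y) :: R, p.2 ∈ P.noFreeTerm (X p.1)) →
    List.IsChain (fun p q : ι × A => p.1 ≠ q.1) (L ++ (i, y) :: R) →
    (∀ p ∈ L.getLast?, p.1 < i) → (∀ p ∈ R.head?, p.1 < i) →
    P.E ((L.map Prod.snd).prod * y * (R.map Prod.snd).prod) =
      P.E ((L.map Prod.snd).prod * P.incl (P.E y) * (R.map Prod.snd).prod)

/-- The normalized partial sums `S_N = (X₁ + ⋯ + X_N) / √N` (with the index shifted to start
at `0`). -/
noncomputable def normalizedSum (X : ℕ → A) (N : ℕ) : A :=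
  ((Real.sqrt N : ℂ)⁻¹) • ∑ i ∈ Finset.range N, X i

end CStarProbSpace

/-- `𝔞` is the `B`-valued arcsine law of variance `η`: the weak limit of the distributions of
`(X₁ + ⋯ + X_N) / √N` for centered, identically distributed, monotone independent self-adjoint
elements `Xᵢ` of a `B`-valued C*-probability space with `E (Xᵢ b Xᵢ) = η b`. -/
def IsArcsineLaw.{u, v} {B : Type u} [CStarAlgebra B] [PartialOrder B] [StarOrderedRing B]
    (η : B → B) (𝔞 : NCPoly B →ₗ[ℂ] B) : Prop :=
  ∃ (A : Type v) (_ : CStarAlgebra A) (P : CStarProbSpace B A) (X : ℕ → A),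
    (∀ i, IsSelfAdjoint (X i)) ∧
    (∀ i, P.E (X i) = 0) ∧
    (∀ i k, P.law (X i) = P.law (X k)) ∧
    P.MonotoneIndep X ∧
    (∀ i b, P.E (X i * P.incl b * X i) = η b) ∧
    ∀ f : NCPoly B, Filter.Tendsto
      (fun N : ℕ => P.law (CStarProbSpace.normalizedSum X N) f) Filter.atTop (𝓝 (𝔞 f))

/-- The operator upper half-plane `ℍ⁺(B)` of the elements with strictly positive (that is,
positive and invertible) imaginary part `(b - b*) / 2i`. -/
def operatorUpperHalfPlane (B : Type*) [CStarAlgebra B] [PartialOrder B] [StarOrderedRing B] :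
    Set B :=
  {b | IsStrictlyPositive ((ℑ b : selfAdjoint B) : B)}

/-- `G` is the Cauchy transform on `ℍ⁺(B)` of the distribution `μ`: `G b = E ((b - X)⁻¹)` for a
self-adjoint `X`, in some `B`-valued C*-probability space, whose distribution is `μ`. (For
`b ∈ ℍ⁺(B)` the element `b - X` is invertible.) -/
def IsCauchyTransform.{u, v} {B : Type u} [CStarAlgebra B] [PartialOrder B] [StarOrderedRing B]
    (μ : NCPoly B →ₗ[ℂ] B) (G : B → B) : Prop :=
  ∃ (A : Type v) (_ : CStarAlgebra A) (P : CStarProbSpace B A) (X : A),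
    IsSelfAdjoint X ∧ P.law X = μ ∧
    ∀ b ∈ operatorUpperHalfPlane B, G b = P.E (Ring.inverse (P.incl b - X))

universe u v w

/-! Put c = b⁻¹ and attach to x ∈ A the formal Cauchy transform F_x(g) = E(g (1 - z x g)⁻¹) on B⟦z⟧.
At the constant series c its coefficients are the moments E(c (x c)ⁿ), so F_x(c) formally represents
E((b - z x)⁻¹). Monotone independence turns sums into compositions
(`MonotoneIndep.cauchySeries_add`), hence a sum of N identically distributed terms into the N-th
iterate of F = F_{X 0} (`MonotoneIndep.cauchySeries_sum_range`).

For a centered element of variance b ↦ a b a, F(g) = g + z² g a g a g + O(z³) (`cauchySeries_eq`).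
The iteration is thus an Euler scheme: after z ↦ z/√N the cubic remainder disappears, and a
Stolz–Cesàro argument in each degree gives z γ' = 2 z² γ a γ a γ for the limiting moment series γ
(`eulerD_of_centralLimit`).

With U = aγ and V = bγ this reads z U' = 2 z² U³, z V' = 2 z² V U². The commutator UV - VU, and then
V² - 1 - 2 z² U², solve homogeneous linear equations with zero initial value, so both vanish
(`sq_eq_of_eulerD`).

For small real s, γ sums to E((b - s x)⁻¹), which is real analytic on all of ℝ since b - s x is
always invertible. The identity theorem carries the relation to s = 1 (`sq_mul_cauchyTransform`).
The second variance is the first one with √2 a in place of a. -/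

namespace PowerSeries

/-! ### Geometric series over a noncommutative ring, and coefficientwise linear maps. -/

section Geom

variable {R : Type*} [Ring R]

/-- The inverse `(1 - z f)⁻¹` of the power series `1 - z f`. -/
noncomputable def geom (f : R⟦X⟧) : R⟦X⟧ := invOfUnit (1 - X * f) 1

theorem mul_geom (f : R⟦X⟧) : (1 - X * f) * geom f = 1 :=
  mul_invOfUnit _ _ (by simp)

theorem geom_mul (f : R⟦X⟧) : geom f * (1 - X * f) = 1 :=
  MvPowerSeries.invOfUnit_mul (1 - X * f) 1 (by
    change constantCoeff (1 - X * f) = _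
    simp)

theorem geom_eq (f : R⟦X⟧) : geom f = 1 + X * (f * geom f) := by
  have h := mul_geom f
  rw [sub_mul, one_mul, sub_eq_iff_eq_add, mul_assoc] at h
  exact h

theorem geom_eq' (f : R⟦X⟧) : geom f = 1 + X * (geom f * f) := by
  have h := geom_mul f
  rw [mul_sub, mul_one, sub_eq_iff_eq_add, ← mul_assoc, ← X_mul, mul_assoc] at h
  exact h

theorem eq_mul_geom {f g h : R⟦X⟧} (H : g * (1 - X * f) = h) : g = h * geom f := by
  rw [← H, mul_assoc, mul_geom, mul_one]

theorem eq_geom_mul {f g h : R⟦X⟧} (H : (1 - X * f) * g = h) : g = geom f * h := by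
  rw [← H, ← mul_assoc, geom_mul, one_mul]

/-- The push-through identity: (1 - z g f) g = g (1 - z f g), because z is central. -/
theorem mul_geom_mul (f g : R⟦X⟧) : g * geom (f * g) = geom (g * f) * g := by
  apply eq_geom_mul
  have h : (1 - X * (g * f)) * g = g * (1 - X * (f * g)) := by
    rw [sub_mul, mul_sub, one_mul, mul_one, ← mul_assoc g X, ← X_mul]
    simp only [mul_assoc]
  rw [← mul_assoc, h, mul_assoc, mul_geom, mul_one]

theorem map_geom {S : Type*} [Ring S] (φ : R →+* S) (f : R⟦X⟧) :
    map φ (geom f) = geom (map φ f) := by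
  have h := congrArg (map φ) (mul_geom f)
  rw [map_mul, map_sub, map_mul, map_one, map_X] at h
  simpa using eq_geom_mul h

theorem coeff_mul_mem (S : Subring R) {f g : R⟦X⟧} (hf : ∀ n, coeff n f ∈ S)
    (hg : ∀ n, coeff n g ∈ S) (n : ℕ) : coeff n (f * g) ∈ S := by
  rw [coeff_mul]
  exact S.sum_mem fun p _ => S.mul_mem (hf _) (hg _)

theorem coeff_geom_mem (S : Subring R) {f : R⟦X⟧} (hf : ∀ n, coeff n f ∈ S) (n : ℕ) :
    coeff n (geom f) ∈ S := by
  induction n using Nat.strong_induction_on with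
  | _ n ih =>
    rw [geom_eq]
    cases n with
    | zero => simp [S.one_mem]
    | succ n =>
      rw [map_add, coeff_succ_X_mul, coeff_mul, coeff_one, if_neg n.succ_ne_zero, zero_add]
      refine S.sum_mem fun p hp => S.mul_mem (hf _) (ih _ ?_)
      have := Finset.HasAntidiagonal.mem_antidiagonal.1 hp
      omega

theorem coeff_C_mem (S : Subring R) {x : R} (hx : x ∈ S) (n : ℕ) : coeff n (C x) ∈ S := by
  rw [coeff_C]
  split_ifs
  exacts [hx, S.zero_mem]

/-- The coefficient of `z ^ n` in `c (1 - z x c)⁻¹`. -/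
theorem coeff_C_mul_geom (x c : R) (n : ℕ) :
    coeff n (C c * geom (C x * C c)) = c * (x * c) ^ n := by
  rw [coeff_C_mul]
  congr 1
  induction n with
  | zero => rw [geom_eq]; simp
  | succ n ih =>
    rw [geom_eq, map_add, coeff_succ_X_mul, ← map_mul, coeff_C_mul, map_mul, ih, pow_succ']
    simp [coeff_one]

end Geom

section CoeffMap

variable {A B : Type*} [Ring A] [Algebra ℂ A] [Ring B] [Algebra ℂ B]

/-- The linear map of power series that acts by `L` on each coefficient. -/
noncomputable def coeffMap (L : A →ₗ[ℂ] B) : A⟦X⟧ →+ B⟦X⟧ where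
  toFun f := mk fun n => L (coeff n f)
  map_zero' := by ext; simp
  map_add' f g := by ext; simp

@[simp] theorem coeff_coeffMap (L : A →ₗ[ℂ] B) (f : A⟦X⟧) (n : ℕ) :
    coeff n (coeffMap L f) = L (coeff n f) := by simp [coeffMap]

theorem coeffMap_X_mul (L : A →ₗ[ℂ] B) (f : A⟦X⟧) :
    coeffMap L (X * f) = X * coeffMap L f := by
  ext n
  cases n <;> simp [coeff_succ_X_mul]

end CoeffMap

end PowerSeries

/-! ### Monotone independence, extended from alternating products to spans of words. -/

namespace CStarProbSpace

variable {B A : Type*} [CStarAlgebra B] [PartialOrder B] [StarOrderedRing B] [CStarAlgebra A]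
  (P : CStarProbSpace B A)

theorem E_incl_mul (b : B) (x : A) : P.E (P.incl b * x) = b * P.E x := by
  simpa using P.E_bimodule b x 1

theorem E_mul_incl (x : A) (b : B) : P.E (x * P.incl b) = P.E x * b := by
  simpa using P.E_bimodule 1 x b

theorem eval_X (x : A) : P.eval x NCPoly.X = x := NCPoly.eval_X _ _

theorem eval_C (x : A) (b : B) : P.eval x (NCPoly.C b) = P.incl b := NCPoly.eval_C _ _ _

theorem incl_mem_range_eval (x : A) (b : B) : P.incl b ∈ (P.eval x).range :=
  ⟨NCPoly.C b, P.eval_C x b⟩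

theorem self_mem_range_eval (x : A) : x ∈ (P.eval x).range := ⟨NCPoly.X, P.eval_X x⟩

theorem mul_self_mul_mem_noFreeTerm {x u v : A} (hu : u ∈ (P.eval x).range)
    (hv : v ∈ (P.eval x).range) : u * x * v ∈ P.noFreeTerm x := by
  obtain ⟨f, rfl⟩ := hu
  obtain ⟨g, rfl⟩ := hv
  exact ⟨f * NCPoly.X * g, Submodule.subset_span ⟨f, g, rfl⟩, by simp [P.eval_X]⟩

theorem mul_mem_noFreeTerm {x u y : A} (hu : u ∈ (P.eval x).range) (hy : y ∈ P.noFreeTerm x) :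
    u * y ∈ P.noFreeTerm x := by
  obtain ⟨f, rfl⟩ := hu
  obtain ⟨p, hp, rfl⟩ := hy
  refine ⟨f * p, ?_, by simp⟩
  induction hp using Submodule.span_induction with
  | mem p hp =>
    obtain ⟨g, h, rfl⟩ := hp
    exact Submodule.subset_span ⟨f * g, h, by simp only [mul_assoc]⟩
  | zero => simp
  | add p q _ _ hp hq => rw [mul_add]; exact add_mem hp hq
  | smul z p _ hp => rw [mul_smul_comm]; exact Submodule.smul_mem _ _ hp

section Words

variable {ι : Type*} (X : ι → A)

/-- The product `X i₁ b₁ ⋯ X iₙ bₙ` for a list of pairs `(i, b)`. -/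
noncomputable def wordProd (t : List (ι × B)) : A :=
  (t.map fun p => X p.1 * P.incl p.2).prod

@[simp] theorem wordProd_nil : P.wordProd X [] = 1 := rfl

@[simp] theorem wordProd_cons (p : ι × B) (t : List (ι × B)) :
    P.wordProd X (p :: t) = X p.1 * P.incl p.2 * P.wordProd X t := by
  simp [wordProd]

@[simp] theorem wordProd_append (s t : List (ι × B)) :
    P.wordProd X (s ++ t) = P.wordProd X s * P.wordProd X t := by
  simp [wordProd]

/-- Grouping equal neighbouring indices, a word is a product of elements without free term whose
consecutive indices differ. -/
theorem exists_isChain_prod_eq_wordProd (t : List (ι × B)) :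
    ∃ T : List (ι × A), (∀ q ∈ T, q.2 ∈ P.noFreeTerm (X q.1)) ∧
      T.IsChain (fun p q => p.1 ≠ q.1) ∧ (T.map Prod.snd).prod = P.wordProd X t ∧
      T.head?.map Prod.fst = t.head?.map Prod.fst ∧
      T.getLast?.map Prod.fst = t.getLast?.map Prod.fst := by
  classical
  induction t with
  | nil => exact ⟨[], by simp⟩
  | cons p t ih =>
    obtain ⟨i, b⟩ := p
    obtain ⟨T, hT, hc, hp, hh, hl⟩ := ih
    have hx : X i * P.incl b ∈ P.noFreeTerm (X i) := by
      simpa using P.mul_self_mul_mem_noFreeTerm (one_mem _) (P.incl_mem_range_eval (X i) b)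
    cases T with
    | nil =>
      have ht : t = [] := by simpa using hh
      subst ht
      exact ⟨[(i, X i * P.incl b)], by simpa using hx, by simp, by simp, by simp, by simp⟩
    | cons q T =>
      obtain ⟨j, y⟩ := q
      obtain ⟨p', t, rfl⟩ : ∃ p' t', t = p' :: t' := by
        cases t with
        | nil => simp at hh
        | cons p' t' => exact ⟨p', t', rfl⟩
      by_cases hij : i = j
      · subst hij
        refine ⟨(i, X i * P.incl b * y) :: T, ?_, ?_, ?_, by simp, ?_⟩
        · intro q hq
          rcases List.mem_cons.1 hq with rfl | hq
          · exact P.mul_mem_noFreeTerm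
              (mul_mem (P.self_mem_range_eval _) (P.incl_mem_range_eval _ b)) (hT (i, y) (by simp))
          · exact hT _ (by simp [hq])
        · rw [List.isChain_cons] at hc ⊢
          exact hc
        · rw [wordProd_cons, ← hp]
          simp [mul_assoc]
        · rw [List.getLast?_cons_cons, ← hl]
          cases T <;> simp
      · refine ⟨(i, X i * P.incl b) :: (j, y) :: T, ?_, ?_, ?_, by simp, ?_⟩
        · intro q hq
          rcases List.mem_cons.1 hq with rfl | hq
          · exact hx
          · exact hT _ hq
        · rw [List.isChain_cons_cons]
          exact ⟨hij, hc⟩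
        · rw [wordProd_cons, ← hp]
          simp
        · rw [List.getLast?_cons_cons, List.getLast?_cons_cons, ← hl]

/-- The subalgebra generated by `B` and the `X i`. -/
noncomputable def generated : Subalgebra ℂ A :=
  Algebra.adjoin ℂ (Set.range P.incl ∪ Set.range X)

theorem incl_mem_generated (b : B) : P.incl b ∈ P.generated X :=
  Algebra.subset_adjoin (Or.inl ⟨b, rfl⟩)

theorem self_mem_generated (i : ι) : X i ∈ P.generated X :=
  Algebra.subset_adjoin (Or.inr ⟨i, rfl⟩)

theorem generated_le_span : Subalgebra.toSubmodule (P.generated X) ≤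
    Submodule.span ℂ {w | ∃ (b : B) (s : List (ι × B)), w = P.incl b * P.wordProd X s} := by
  intro w hw
  rw [generated, Algebra.adjoin_eq_span] at hw
  refine Submodule.span_le.2 (fun w hw => ?_) hw
  induction hw using Submonoid.closure_induction_left with
  | one => exact Submodule.subset_span ⟨1, [], by simp⟩
  | mul_left x hx y hy' hy =>
    clear hy'
    rw [SetLike.mem_coe] at hy ⊢
    induction hy using Submodule.span_induction with
    | mem y hy =>
      obtain ⟨b, s, rfl⟩ := hy
      rcases hx with ⟨c, rfl⟩ | ⟨i, rfl⟩
      · exact Submodule.subset_span ⟨c * b, s, by simp [mul_assoc]⟩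
      · exact Submodule.subset_span ⟨1, (i, b) :: s, by simp [mul_assoc]⟩
    | zero => simp
    | add y z _ _ hy hz =>
      rw [mul_add]; exact add_mem hy hz
    | smul z y _ hy =>
      rw [mul_smul_comm]; exact Submodule.smul_mem _ _ hy

variable [LinearOrder ι] {X}

/-- Grouping equal neighbours makes both outer words alternating without changing their end indices.
The indices adjacent to `y` are below `k`, so the whole list stays alternating and the definition
applies. -/
theorem MonotoneIndep.E_wordProd {P : CStarProbSpace B A} (h : P.MonotoneIndep X) {k : ι}
    {s t : List (ι × B)}
    (hs : ∀ p ∈ s.getLast?, p.1 < k) (ht : ∀ p ∈ t.head?, p.1 < k) {y : A}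
    (hy : y ∈ P.noFreeTerm (X k)) :
    P.E (P.wordProd X s * y * P.wordProd X t) =
      P.E (P.wordProd X s * P.incl (P.E y) * P.wordProd X t) := by
  obtain ⟨L, hL, hLc, hLp, -, hLl⟩ := P.exists_isChain_prod_eq_wordProd X s
  obtain ⟨R, hR, hRc, hRp, hRh, -⟩ := P.exists_isChain_prod_eq_wordProd X t
  have hL' : ∀ p ∈ L.getLast?, p.1 < k := by
    intro p hp
    rw [Option.mem_def] at hp
    rw [hp, Option.map_some, eq_comm, Option.map_eq_some_iff] at hLl
    obtain ⟨q, hq, hqp⟩ := hLl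
    exact hqp ▸ hs q hq
  have hR' : ∀ p ∈ R.head?, p.1 < k := by
    intro p hp
    rw [Option.mem_def] at hp
    rw [hp, Option.map_some, eq_comm, Option.map_eq_some_iff] at hRh
    obtain ⟨q, hq, hqp⟩ := hRh
    exact hqp ▸ ht q hq
  rw [← hLp, ← hRp]
  refine h L R k y ?_ ?_ hL' hR'
  · intro p hp
    rcases List.mem_append.1 hp with hp | hp
    · exact hL p hp
    · rcases List.mem_cons.1 hp with rfl | hp
      · exact hy
      · exact hR p hp
  · rw [List.isChain_append, List.isChain_cons]
    refine ⟨hLc, ⟨fun q hq => (hR' q hq).ne', hRc⟩, fun p hp q hq => ?_⟩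
    simp only [List.head?_cons, Option.mem_def, Option.some.injEq] at hq
    exact hq ▸ (hL' p hp).ne

variable (X)

/-- The span of the words `b₀ X i₁ b₁ ⋯ X iₙ bₙ` that do not end with an index `≥ k`. -/
noncomputable def leftWords (k : ι) : Submodule ℂ A :=
  Submodule.span ℂ {w | ∃ (b : B) (s : List (ι × B)),
    (∀ p ∈ s.getLast?, p.1 < k) ∧ w = P.incl b * P.wordProd X s}

/-- The span of the words `X i₁ b₁ ⋯ X iₙ bₙ` that do not begin with an index `≥ k`. -/
noncomputable def rightWords (k : ι) : Submodule ℂ A :=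
  Submodule.span ℂ {w | ∃ t : List (ι × B), (∀ p ∈ t.head?, p.1 < k) ∧ w = P.wordProd X t}

theorem one_mem_leftWords (k : ι) : (1 : A) ∈ P.leftWords X k :=
  Submodule.subset_span ⟨1, [], by simp, by simp⟩

theorem one_mem_rightWords (k : ι) : (1 : A) ∈ P.rightWords X k :=
  Submodule.subset_span ⟨[], by simp, by simp⟩

theorem mul_self_mem_leftWords {k i : ι} (hi : i < k) {w : A} (hw : w ∈ P.generated X) :
    w * X i ∈ P.leftWords X k := by
  replace hw := P.generated_le_span X hw
  induction hw using Submodule.span_induction with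
  | mem w hw =>
    obtain ⟨b, s, rfl⟩ := hw
    exact Submodule.subset_span ⟨b, s ++ [(i, 1)], by simpa using hi, by simp [mul_assoc]⟩
  | zero => simp
  | add x y _ _ hx hy => rw [add_mul]; exact add_mem hx hy
  | smul z x _ hx => rw [smul_mul_assoc]; exact Submodule.smul_mem _ _ hx

theorem self_mul_mem_rightWords {k i : ι} (hi : i < k) {w : A} (hw : w ∈ P.generated X) :
    X i * w ∈ P.rightWords X k := by
  replace hw := P.generated_le_span X hw
  induction hw using Submodule.span_induction with
  | mem w hw =>
    obtain ⟨b, s, rfl⟩ := hw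
    exact Submodule.subset_span ⟨(i, b) :: s, by simpa using hi, by simp [mul_assoc]⟩
  | zero => simp
  | add x y _ _ hx hy => rw [mul_add]; exact add_mem hx hy
  | smul z x _ hx => rw [mul_smul_comm]; exact Submodule.smul_mem _ _ hx

variable {X} {P}

/-- Monotone independence in a form that is linear in all factors. -/
theorem MonotoneIndep.E_mul_mul (h : P.MonotoneIndep X) {k : ι} {l y r : A}
    (hl : l ∈ P.leftWords X k) (hy : y ∈ P.noFreeTerm (X k)) (hr : r ∈ P.rightWords X k) :
    P.E (l * y * r) = P.E (l * P.incl (P.E y) * r) := by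
  induction hr using Submodule.span_induction with
  | mem r hr =>
    obtain ⟨t, ht, rfl⟩ := hr
    induction hl using Submodule.span_induction with
    | mem l hl =>
      obtain ⟨b, s, hs, rfl⟩ := hl
      have := h.E_wordProd hs ht hy
      simp only [mul_assoc, E_incl_mul] at this ⊢
      rw [this]
    | zero => simp
    | add l m _ _ hl hm => simp only [add_mul, map_add, hl, hm]
    | smul z l _ hl => simp only [smul_mul_assoc, map_smul, hl]
  | zero => simp
  | add r s _ _ hr hs => simp only [mul_add, map_add, hr, hs]
  | smul z r _ hr => simp only [mul_smul_comm, map_smul, hr]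

end Words

end CStarProbSpace

/-! ### The formal Cauchy transform and its composition law. -/

namespace CStarProbSpace

open PowerSeries (coeffMap coeff geom)
open scoped PowerSeries

variable {B A : Type*} [CStarAlgebra B] [PartialOrder B] [StarOrderedRing B] [CStarAlgebra A]
  (P : CStarProbSpace B A)

/-- The inclusion `B⟦z⟧ → A⟦z⟧`. -/
noncomputable def inclSeries : B⟦X⟧ →+* A⟦X⟧ := PowerSeries.map (P.incl : B →+* A)

@[simp] theorem coeff_inclSeries (g : B⟦X⟧) (n : ℕ) :
    coeff n (P.inclSeries g) = P.incl (coeff n g) := by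
  simp [inclSeries]

@[simp] theorem inclSeries_C (b : B) :
    P.inclSeries (PowerSeries.C b) = PowerSeries.C (P.incl b) := by
  simp [inclSeries]

theorem coeffMap_inclSeries (g : B⟦X⟧) : coeffMap P.E (P.inclSeries g) = g := by
  ext n
  simp [P.E_incl]

theorem coeffMap_inclSeries_mul (g : B⟦X⟧) (f : A⟦X⟧) :
    coeffMap P.E (P.inclSeries g * f) = g * coeffMap P.E f := by
  ext n
  simp [PowerSeries.coeff_mul, P.E_incl_mul]

theorem coeffMap_mul_inclSeries (f : A⟦X⟧) (g : B⟦X⟧) :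
    coeffMap P.E (f * P.inclSeries g) = coeffMap P.E f * g := by
  ext n
  simp [PowerSeries.coeff_mul, P.E_mul_incl]

/-- The formal Cauchy transform `g ↦ E (g (1 - z x g)⁻¹)` of `x`, as a map of power series. -/
noncomputable def cauchySeries (x : A) (g : B⟦X⟧) : B⟦X⟧ :=
  coeffMap P.E (P.inclSeries g * geom (PowerSeries.C x * P.inclSeries g))

theorem cauchySeries_zero (g : B⟦X⟧) : P.cauchySeries 0 g = g := by
  have : geom (0 : A⟦X⟧) = 1 := by rw [PowerSeries.geom_eq]; simp
  simp [cauchySeries, this, coeffMap_inclSeries]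

/-- The formal Cauchy transform depends only on the distribution. -/
theorem cauchySeries_congr {x y : A} (h : P.law x = P.law y) :
    P.cauchySeries x = P.cauchySeries y := by
  funext g
  -- Lifting the coefficients of g to constant polynomials exhibits the transform as the law applied
  -- coefficientwise to a series that does not involve `x`.
  let g' : (NCPoly B)⟦X⟧ := PowerSeries.mk fun n => NCPoly.C (coeff n g)
  have key : ∀ x : A, P.cauchySeries x g =
      coeffMap (P.law x) (g' * geom (PowerSeries.C NCPoly.X * g')) := by
    intro x
    have hg : PowerSeries.map (P.eval x : NCPoly B →+* A) g' = P.inclSeries g := by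
      ext n
      simp [g', P.eval_C]
    have hx : PowerSeries.map (P.eval x : NCPoly B →+* A) (PowerSeries.C NCPoly.X) =
        PowerSeries.C x := by
      simp [P.eval_X]
    rw [cauchySeries, ← hg, ← hx, ← map_mul, ← PowerSeries.map_geom, ← map_mul]
    ext n
    rw [PowerSeries.coeff_coeffMap, PowerSeries.coeff_coeffMap, PowerSeries.coeff_map]
    rfl
  rw [key, key, h]

theorem MonotoneIndep.coeffMap_mul_mul {P : CStarProbSpace B A} {ι : Type*} [LinearOrder ι]
    {X : ι → A} (h : P.MonotoneIndep X) {k : ι} {l y r : A⟦X⟧}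
    (hl : ∀ n, coeff n l ∈ P.leftWords X k) (hy : ∀ n, coeff n y ∈ P.noFreeTerm (X k))
    (hr : ∀ n, coeff n r ∈ P.rightWords X k) :
    coeffMap P.E (l * y * r) = coeffMap P.E (l * P.inclSeries (coeffMap P.E y) * r) := by
  ext n
  simp only [PowerSeries.coeff_coeffMap, PowerSeries.coeff_mul, map_sum, Finset.sum_mul,
    coeff_inclSeries]
  exact Finset.sum_congr rfl fun p _ => Finset.sum_congr rfl fun q _ =>
    h.E_mul_mul (hl _) (hy _) (hr _)

/-- Formal Cauchy transforms of monotone independent elements compose. -/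
theorem MonotoneIndep.cauchySeries_add {P : CStarProbSpace B A} {ι : Type*} [LinearOrder ι]
    {X : ι → A} (h : P.MonotoneIndep X) (s : Finset ι) {k : ι} (hs : ∀ i ∈ s, i < k)
    (g : B⟦X⟧) :
    P.cauchySeries (∑ i ∈ s, X i + X k) g =
      P.cauchySeries (∑ i ∈ s, X i) (P.cauchySeries (X k) g) := by
  set S : A⟦X⟧ := PowerSeries.C (∑ i ∈ s, X i) with hS
  set Y : A⟦X⟧ := PowerSeries.C (X k) with hY
  set c : A⟦X⟧ := P.inclSeries g with hc
  set r : A⟦X⟧ := c * geom (Y * c) with hr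
  set D : A⟦X⟧ := P.inclSeries (P.cauchySeries (X k) g) with hD
  -- Here r is the resolvent of `X k` before taking E, and 1 - z(S + Y)c = (1 - zSr)(1 - zYc).
  have h1 : c * geom ((S + Y) * c) = r * geom (S * r) := by
    apply PowerSeries.eq_mul_geom
    apply PowerSeries.eq_mul_geom
    have h2 : r * (1 - PowerSeries.X * (Y * c)) = c := by
      rw [hr, mul_assoc, PowerSeries.geom_mul, mul_one]
    have h3 : (1 - PowerSeries.X * (S * r)) * (1 - PowerSeries.X * (Y * c)) =
        1 - PowerSeries.X * ((S + Y) * c) := by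
      rw [sub_mul, one_mul, mul_assoc, mul_assoc, h2]
      simp only [add_mul, mul_add]
      abel
    rw [mul_assoc, h3, mul_assoc, PowerSeries.geom_mul, mul_one]
  -- The resolvent identity, with D = E(r). It remains to show that E kills the right-hand side,
  -- whose middle factor r - D is centered.
  have h2 : r * geom (S * r) - D * geom (S * D) = geom (D * S) * (r - D) * geom (S * r) := by
    have e1 : r * geom (S * r) =
        geom (D * S) * ((1 - PowerSeries.X * (D * S)) * r) * geom (S * r) := by
      rw [← mul_assoc (geom (D * S)), PowerSeries.geom_mul, one_mul]
    have e2 : D * geom (S * D) =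
        geom (D * S) * (D * (1 - PowerSeries.X * (S * r))) * geom (S * r) := by
      rw [PowerSeries.mul_geom_mul, mul_assoc, mul_assoc D, PowerSeries.mul_geom, mul_one]
    rw [e1, e2, ← sub_mul, ← mul_sub]
    congr 2
    rw [sub_mul, mul_sub, one_mul, mul_one, ← mul_assoc D PowerSeries.X, ← PowerSeries.X_mul]
    simp only [mul_assoc]
    abel
  have hcmem : ∀ n, coeff n c ∈ (P.eval (X k)).range.toSubring := fun n => by
    rw [hc, coeff_inclSeries]
    exact P.incl_mem_range_eval _ _
  have hrmem : ∀ n, coeff n r ∈ (P.eval (X k)).range.toSubring :=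
    PowerSeries.coeff_mul_mem _ hcmem (PowerSeries.coeff_geom_mem _
      (PowerSeries.coeff_mul_mem _ (PowerSeries.coeff_C_mem _ (P.self_mem_range_eval _)) hcmem))
  -- Independence needs a middle factor without free term. This holds for r - c, and r - D = (r - c)
  -- - E(r - c).
  have hy : ∀ n, coeff n (r - c) ∈ P.noFreeTerm (X k) := by
    have e : r - c = PowerSeries.X * (c * Y * r) := by
      conv_lhs => rw [hr, PowerSeries.geom_eq, mul_add, mul_one, add_sub_cancel_left,
        ← mul_assoc c, ← PowerSeries.X_mul]
      simp only [hr, mul_assoc]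
    intro n
    rw [e]
    cases n with
    | zero => simp
    | succ n =>
      rw [PowerSeries.coeff_succ_X_mul, PowerSeries.coeff_mul]
      refine Submodule.sum_mem _ fun p _ => ?_
      rw [hY, PowerSeries.coeff_mul_C]
      exact P.mul_self_mul_mem_noFreeTerm (hcmem _) (hrmem _)
  have hgen : ∀ n, coeff n r ∈ (P.generated X).toSubring := by
    have hcm : ∀ n, coeff n c ∈ (P.generated X).toSubring := fun n => by
      rw [hc, coeff_inclSeries]
      exact P.incl_mem_generated _ _
    exact PowerSeries.coeff_mul_mem _ hcm (PowerSeries.coeff_geom_mem _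
      (PowerSeries.coeff_mul_mem _ (PowerSeries.coeff_C_mem _ (P.self_mem_generated X k)) hcm))
  have hDgen : ∀ n, coeff n D ∈ (P.generated X).toSubring := fun n => by
    rw [hD, coeff_inclSeries]
    exact P.incl_mem_generated _ _
  have hSgen : ∀ n, coeff n S ∈ (P.generated X).toSubring :=
    PowerSeries.coeff_C_mem _ (Subring.sum_mem _ fun i _ => P.self_mem_generated X i)
  -- Apart from 1, every term ends with a letter from S, whose index is below `k`.
  have hl : ∀ n, coeff n (geom (D * S)) ∈ P.leftWords X k := by
    intro n
    rw [PowerSeries.geom_eq']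
    cases n with
    | zero => simpa using P.one_mem_leftWords X k
    | succ n =>
      rw [map_add, PowerSeries.coeff_succ_X_mul, PowerSeries.coeff_one, if_neg n.succ_ne_zero,
        zero_add, ← mul_assoc, hS, PowerSeries.coeff_mul_C, Finset.mul_sum]
      exact Submodule.sum_mem _ fun i hi => P.mul_self_mem_leftWords X (hs i hi)
        (PowerSeries.coeff_mul_mem _ (PowerSeries.coeff_geom_mem _
          (PowerSeries.coeff_mul_mem _ hDgen hSgen)) hDgen n)
  -- Only the first letter matters, and it comes from S; the occurrences of `X k` inside r are
  -- harmless.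
  have hq : ∀ n, coeff n (geom (S * r)) ∈ P.rightWords X k := by
    intro n
    rw [PowerSeries.geom_eq]
    cases n with
    | zero => simpa using P.one_mem_rightWords X k
    | succ n =>
      rw [map_add, PowerSeries.coeff_succ_X_mul, PowerSeries.coeff_one, if_neg n.succ_ne_zero,
        zero_add, mul_assoc, hS, PowerSeries.coeff_C_mul, Finset.sum_mul]
      exact Submodule.sum_mem _ fun i hi => P.self_mul_mem_rightWords X (hs i hi)
        (PowerSeries.coeff_mul_mem _ hgen (PowerSeries.coeff_geom_mem _
          (PowerSeries.coeff_mul_mem _ hSgen hgen)) n)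
  have hD' : D = c + P.inclSeries (coeffMap P.E (r - c)) := by
    rw [map_sub, map_sub, hc, coeffMap_inclSeries, ← hc, add_sub_cancel]
    rfl
  have key := h.coeffMap_mul_mul hl hy hq
  rw [← sub_eq_zero, ← map_sub, ← sub_mul, ← mul_sub] at key
  rw [cauchySeries, cauchySeries, map_add, ← hc, h1, ← sub_eq_zero, ← map_sub]
  change coeffMap P.E (r * geom (S * r) - D * geom (S * D)) = 0
  rw [h2, ← key]
  congr 3
  rw [hD']
  abel

/-- The formal Cauchy transform of a sum of monotone independent, identically distributed
elements is an iterate. -/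
theorem MonotoneIndep.cauchySeries_sum_range {P : CStarProbSpace B A} {X : ℕ → A}
    (h : P.MonotoneIndep X) (hlaw : ∀ i k, P.law (X i) = P.law (X k)) (N : ℕ) :
    P.cauchySeries (∑ i ∈ Finset.range N, X i) = (P.cauchySeries (X 0))^[N] := by
  induction N with
  | zero => funext g; simp [cauchySeries_zero]
  | succ N ih =>
    funext g
    rw [Finset.sum_range_succ, h.cauchySeries_add _ (fun i hi => Finset.mem_range.1 hi),
      ih, P.cauchySeries_congr (hlaw N 0), Function.iterate_succ_apply]

/-- Expansion of the formal Cauchy transform of a centered element of variance `b ↦ a b a`. -/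
theorem cauchySeries_eq (x : A) (a : B) (hx : P.E x = 0)
    (hv : ∀ b, P.E (x * P.incl b * x) = a * b * a) (g : B⟦X⟧) :
    P.cauchySeries x g = g +
      PowerSeries.X ^ 2 * (g * PowerSeries.C a * g * PowerSeries.C a * g) +
      PowerSeries.X ^ 3 * coeffMap P.E (P.inclSeries g * (PowerSeries.C x * P.inclSeries g) ^ 3 *
        geom (PowerSeries.C x * P.inclSeries g)) := by
  set c := P.inclSeries g with hc
  set Y : A⟦X⟧ := PowerSeries.C x with hY
  have hexp : c * geom (Y * c) = c + PowerSeries.X * (c * Y * c) +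
      PowerSeries.X * (PowerSeries.X * (c * (Y * c * Y) * c)) +
      PowerSeries.X * (PowerSeries.X * (PowerSeries.X * (c * (Y * c) ^ 3 * geom (Y * c)))) := by
    have e : ∀ u : A⟦X⟧, u * geom (Y * c) = u + PowerSeries.X * (u * (Y * c) * geom (Y * c)) := by
      intro u
      conv_lhs => rw [PowerSeries.geom_eq, mul_add, mul_one, ← mul_assoc u, ← PowerSeries.X_mul]
      simp only [mul_assoc]
    rw [e c, e (c * (Y * c)), e (c * (Y * c) * (Y * c))]
    simp only [mul_add, pow_succ, pow_zero, one_mul, mul_assoc, add_assoc]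
  have h1 : coeffMap P.E Y = 0 := by
    ext n
    rw [PowerSeries.coeff_coeffMap, hY, PowerSeries.coeff_C]
    split_ifs <;> simp [hx]
  have h2 : coeffMap P.E (Y * c * Y) = PowerSeries.C a * g * PowerSeries.C a := by
    ext n
    rw [PowerSeries.coeff_coeffMap, hY, PowerSeries.coeff_mul_C, PowerSeries.coeff_C_mul, hc,
      coeff_inclSeries, hv, PowerSeries.coeff_mul_C, PowerSeries.coeff_C_mul]
  rw [cauchySeries, ← hc, ← hY, hexp]
  simp only [map_add, PowerSeries.coeffMap_X_mul]
  rw [hc, coeffMap_mul_inclSeries, coeffMap_mul_inclSeries, coeffMap_inclSeries_mul,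
    coeffMap_inclSeries_mul, coeffMap_inclSeries, ← hc, h1, h2]
  simp only [pow_succ, pow_zero, one_mul, mul_assoc, mul_zero, zero_mul, add_zero]

end CStarProbSpace

/-! ### Formal differential equations and the conserved quantity. -/

namespace PowerSeries

open Filter

section Euler

variable {R : Type*} [Ring R]

/-- The Euler derivation `z d/dz`. -/
noncomputable def eulerD : R⟦X⟧ →+ R⟦X⟧ where
  toFun f := mk fun n => n • coeff n f
  map_zero' := by ext; simp
  map_add' f g := by ext; simp

theorem coeff_eulerD (f : R⟦X⟧) (n : ℕ) : coeff n (eulerD f) = n • coeff n f := by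
  simp [eulerD]

theorem eulerD_mul (f g : R⟦X⟧) : eulerD (f * g) = eulerD f * g + f * eulerD g := by
  ext n
  simp only [map_add, coeff_eulerD, coeff_mul, Finset.smul_sum, ← Finset.sum_add_distrib]
  refine Finset.sum_congr rfl fun p hp => ?_
  rw [← Finset.HasAntidiagonal.mem_antidiagonal.1 hp, add_smul, smul_mul_assoc, mul_smul_comm]

theorem eulerD_C (x : R) : eulerD (C x) = 0 := by
  ext n
  rw [coeff_eulerD, coeff_C]
  split_ifs with h <;> simp [h]

theorem eulerD_X : eulerD (X : R⟦X⟧) = X := by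
  ext n
  rw [coeff_eulerD, coeff_X]
  split_ifs with h <;> simp [h]

theorem X_pow_dvd_mul_mul {n : ℕ} {f : R⟦X⟧} (h : X ^ n ∣ f) (u v : R⟦X⟧) :
    X ^ n ∣ u * f * v := by
  obtain ⟨g, rfl⟩ := h
  exact ⟨u * g * v, by rw [← mul_assoc u, ← X_pow_mul]; simp only [mul_assoc]⟩

/-- A homogeneous linear differential equation with zero initial value has only the zero
solution. -/
theorem eq_zero_of_eulerD [IsAddTorsionFree R] {f g : R⟦X⟧} (h0 : coeff 0 f = 0)
    (hD : eulerD f = X * g) (hg : ∀ n, X ^ n ∣ f → X ^ n ∣ g) : f = 0 := by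
  -- The hypothesis `hg` stands in for linearity of g in f. Divisibility of f by a power of z passes
  -- to g, and the extra factor z raises the order of z f' by one; dividing by m ≠ 0 raises that of
  -- f.
  have key : ∀ n, X ^ (n + 1) ∣ f := by
    intro n
    induction n with
    | zero => simpa [X_dvd_iff] using h0
    | succ n ih =>
      have hd : X ^ (n + 1 + 1) ∣ eulerD f := by
        rw [hD, pow_succ']
        exact mul_dvd_mul_left X (hg _ ih)
      rw [X_pow_dvd_iff] at hd ⊢
      intro m hm
      rcases Nat.eq_zero_or_pos m with rfl | hm0
      · exact h0
      · have := hd m hm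
        rw [coeff_eulerD] at this
        exact (smul_eq_zero.1 this).resolve_left hm0.ne'
  ext n
  exact X_pow_dvd_iff.1 (key n) n n.lt_succ_self

/-- The conserved quantity of the formal differential equations
`z V' = 2 z² V U²`, `z U' = 2 z² U³`. -/
theorem sq_eq_of_eulerD [IsAddTorsionFree R] {U V : R⟦X⟧}
    (hV : eulerD V = 2 * X ^ 2 * (V * U * U)) (hU : eulerD U = 2 * X ^ 2 * (U * U * U))
    (hV0 : coeff 0 V = 1) (hUV0 : coeff 0 (U * V) = coeff 0 (V * U)) :
    V * V = 1 + 2 * X ^ 2 * (U * U) := by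
  have hX : ∀ f : R⟦X⟧, f * X = X * f := fun f => (X_mul).symm
  have hX' : ∀ f g : R⟦X⟧, f * (X * g) = X * (f * g) := fun f g => by
    rw [← mul_assoc, ← X_mul, mul_assoc]
  -- The commutator K satisfies z K' = 2 z² (U²K + UKU + 2KU²).
  have hK : U * V - V * U = 0 := by
    refine eq_zero_of_eulerD (g := 2 * X * (U * U * (U * V - V * U) + U * (U * V - V * U) * U +
      (U * V - V * U) * (U * U) + (U * V - V * U) * (U * U))) (by rw [map_sub, hUV0, sub_self])
      ?_ ?_
    · rw [map_sub, eulerD_mul, eulerD_mul, hU, hV]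
      simp only [pow_succ, pow_zero, one_mul, mul_add, add_mul, mul_sub, sub_mul, mul_assoc, hX',
        two_mul]
      abel
    · intro n hn
      generalize U * V - V * U = K at hn ⊢
      have e : 2 * X * (U * U * K + U * K * U + K * (U * U) + K * (U * U)) =
          (2 * X * (U * U)) * K * 1 + (2 * X * U) * K * U + (2 * X) * K * (U * U) +
            (2 * X) * K * (U * U) := by
        simp only [mul_add, mul_assoc, mul_one]
      rw [e]
      exact dvd_add (dvd_add (dvd_add (X_pow_dvd_mul_mul hn _ _) (X_pow_dvd_mul_mul hn _ _))
        (X_pow_dvd_mul_mul hn _ _)) (X_pow_dvd_mul_mul hn _ _)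
  have hc : ∀ f, U * (V * f) = V * (U * f) := fun f => by
    rw [← mul_assoc, sub_eq_zero.1 hK, mul_assoc]
  have hc' : U * V = V * U := sub_eq_zero.1 hK
  -- Once U and V commute, the defect W satisfies z W' = 4 z² W U².
  have hW : V * V - 1 - 2 * X ^ 2 * (U * U) = 0 := by
    refine eq_zero_of_eulerD
      (g := 4 * X * ((V * V - 1 - 2 * X ^ 2 * (U * U)) * (U * U))) ?_ ?_ ?_
    · rw [coeff_zero_eq_constantCoeff_apply] at hV0 ⊢
      simp [hV0]
    · have h1 : eulerD (1 : R⟦X⟧) = 0 := by simpa using eulerD_C (1 : R)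
      have h4 : (4 : R⟦X⟧) = 2 * 2 := by norm_num
      rw [two_mul]
      simp only [map_sub, map_add, eulerD_mul, eulerD_X, h1, hU, hV, pow_two, h4]
      simp only [mul_add, add_mul, mul_sub, sub_mul, mul_assoc, hX', hX, one_mul,
        two_mul, hc, hc']
      abel
    · intro n hn
      generalize V * V - 1 - 2 * X ^ 2 * (U * U) = W at hn ⊢
      rw [← mul_assoc]
      exact X_pow_dvd_mul_mul hn _ _
  rw [sub_sub, sub_eq_zero] at hW
  exact hW

end Euler

/-! ### Limits under z ↦ z/√N and Stolz–Cesàro. -/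

section ScaledLimits

variable {R S : Type*} [NormedRing R] [NormedAlgebra ℝ R] [NormedRing S] [NormedAlgebra ℝ S]

/-- Coefficientwise convergence of the power series `g N` after the substitution
`z ↦ z / √N`. -/
def ScaledTendsto (g : ℕ → R⟦X⟧) (γ : R⟦X⟧) : Prop :=
  ∀ n, Tendsto (fun N : ℕ => ((√(N : ℝ))⁻¹) ^ n • coeff n (g N)) atTop (𝓝 (coeff n γ))

theorem scaledTendsto_C (x : R) : ScaledTendsto (fun _ => C x) (C x) := by
  intro n
  rcases Nat.eq_zero_or_pos n with rfl | hn
  · simp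
  · simp [coeff_C, hn.ne']

/-- Convergence is required only up to degree n, so that the lemma can be used inside the induction
on the degree in `ScaledTendsto.geom`. -/
theorem tendsto_coeff_mul {f g : ℕ → R⟦X⟧} {φ γ : R⟦X⟧} {n : ℕ}
    (hf : ∀ i ≤ n, Tendsto (fun N : ℕ => ((√(N : ℝ))⁻¹) ^ i • coeff i (f N)) atTop
      (𝓝 (coeff i φ)))
    (hg : ∀ i ≤ n, Tendsto (fun N : ℕ => ((√(N : ℝ))⁻¹) ^ i • coeff i (g N)) atTop
      (𝓝 (coeff i γ))) :
    Tendsto (fun N : ℕ => ((√(N : ℝ))⁻¹) ^ n • coeff n (f N * g N)) atTop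
      (𝓝 (coeff n (φ * γ))) := by
  simp only [coeff_mul, Finset.smul_sum]
  refine tendsto_finsetSum _ fun p hp => ?_
  have hp' := Finset.HasAntidiagonal.mem_antidiagonal.1 hp
  refine ((hf p.1 (by omega)).mul (hg p.2 (by omega))).congr fun N => ?_
  rw [smul_mul_smul_comm, ← pow_add, hp']

theorem ScaledTendsto.mul {f g : ℕ → R⟦X⟧} {φ γ : R⟦X⟧} (hf : ScaledTendsto f φ)
    (hg : ScaledTendsto g γ) : ScaledTendsto (fun N => f N * g N) (φ * γ) :=
  fun _ => tendsto_coeff_mul (fun i _ => hf i) (fun i _ => hg i)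

theorem tendsto_inv_sqrt_natCast :
    Tendsto (fun N : ℕ => (√(N : ℝ))⁻¹) atTop (𝓝 0) :=
  tendsto_inv_atTop_zero.comp (Real.tendsto_sqrt_atTop.comp tendsto_natCast_atTop_atTop)

/-- Degree n + 1 of (1 - zf)⁻¹ is degree n of f (1 - zf)⁻¹, so the scaling leaves a spare factor
1/√N and only the constant term survives. -/
theorem ScaledTendsto.geom {f : ℕ → R⟦X⟧} {φ : R⟦X⟧} (hf : ScaledTendsto f φ) :
    ScaledTendsto (fun N => PowerSeries.geom (f N)) 1 := by
  intro n
  induction n using Nat.strong_induction_on with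
  | _ n ih =>
    cases n with
    | zero =>
      have e : ∀ N, coeff 0 (PowerSeries.geom (f N)) = 1 := fun N => by rw [geom_eq]; simp
      simp [e]
    | succ n =>
      have h := tendsto_coeff_mul (n := n) (fun i _ => hf i) (fun i hi => ih i (by omega))
      have h' := tendsto_inv_sqrt_natCast.smul h
      rw [zero_smul] at h'
      rw [coeff_one, if_neg n.succ_ne_zero]
      refine h'.congr fun N => ?_
      have e : coeff (n + 1) (PowerSeries.geom (f N)) = coeff n (f N * PowerSeries.geom (f N)) := by
        rw [geom_eq, map_add, coeff_succ_X_mul, coeff_one, if_neg n.succ_ne_zero, zero_add,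
          ← geom_eq]
      rw [e, smul_smul, pow_succ']

theorem ScaledTendsto.map {f : ℕ → R⟦X⟧} {g : ℕ → S⟦X⟧} {φ : R⟦X⟧} {γ : S⟦X⟧}
    (hf : ScaledTendsto f φ) (L : R →L[ℝ] S)
    (hg : ∀ N n, coeff n (g N) = L (coeff n (f N))) (hγ : ∀ n, coeff n γ = L (coeff n φ)) :
    ScaledTendsto g γ := by
  intro n
  rw [hγ]
  refine ((L.continuous.tendsto _).comp (hf n)).congr fun N => ?_
  rw [Function.comp_apply, map_smul, hg]

/-- The increments of `√N ^ m` are asymptotic to `(m / 2) √N ^ (m - 2)`. -/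
theorem tendsto_sqrt_pow_increment (m : ℕ) :
    Tendsto (fun N : ℕ => ((√(N : ℝ))⁻¹) ^ m * (√((N + 1 : ℕ) : ℝ) ^ (m + 2) - √(N : ℝ) ^ (m + 2)))
      atTop (𝓝 ((m + 2 : ℕ) / 2)) := by
  have hu : Tendsto (fun N : ℕ => √(1 + (N : ℝ)⁻¹)) atTop (𝓝 1) := by
    have h : Tendsto (fun N : ℕ => 1 + (N : ℝ)⁻¹) atTop (𝓝 (1 + 0)) :=
      tendsto_const_nhds.add (tendsto_inv_atTop_zero.comp tendsto_natCast_atTop_atTop)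
    rw [add_zero] at h
    simpa using h.sqrt
  -- With u = √(1 + 1/N), the expression is N(u^(m+2) - 1). Since (u - 1)(u + 1) = 1/N, it equals
  -- the geometric sum of u divided by u + 1.
  have h : Tendsto (fun N : ℕ => (∑ i ∈ Finset.range (m + 2), √(1 + (N : ℝ)⁻¹) ^ i) /
      (√(1 + (N : ℝ)⁻¹) + 1)) atTop (𝓝 ((∑ i ∈ Finset.range (m + 2), (1 : ℝ) ^ i) / (1 + 1))) :=
    (tendsto_finsetSum _ fun i _ => hu.pow i).div (hu.add_const 1) (by norm_num)
  have e : (∑ i ∈ Finset.range (m + 2), (1 : ℝ) ^ i) / (1 + 1) = (m + 2 : ℕ) / 2 := by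
    simp; norm_num
  rw [e] at h
  refine h.congr' ?_
  filter_upwards [eventually_gt_atTop 0] with N hN
  have hN' : (0 : ℝ) < N := by exact_mod_cast hN
  have hs : 0 < √(N : ℝ) := Real.sqrt_pos.2 hN'
  have hmul : √((N + 1 : ℕ) : ℝ) = √(N : ℝ) * √(1 + (N : ℝ)⁻¹) := by
    rw [← Real.sqrt_mul hN'.le]
    congr 1
    push_cast
    field_simp
  rw [hmul]
  set u := √(1 + (N : ℝ)⁻¹) with hu
  have hu2 : (u - 1) * (u + 1) = (N : ℝ)⁻¹ := by
    have : u ^ 2 = 1 + (N : ℝ)⁻¹ := Real.sq_sqrt (by positivity)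
    linear_combination this
  have hu1 : 0 < u + 1 := by positivity
  have hs2 : √(N : ℝ) ^ 2 = N := Real.sq_sqrt hN'.le
  have hgeo := geom_sum_mul u (m + 2)
  rw [div_eq_iff hu1.ne', mul_pow, ← mul_sub_one, ← hgeo]
  have : (√(N : ℝ))⁻¹ ^ m * (√(N : ℝ) ^ (m + 2)) = N := by
    rw [pow_add, ← mul_assoc, ← mul_pow, inv_mul_cancel₀ hs.ne', one_pow, one_mul, hs2]
  calc ∑ i ∈ Finset.range (m + 2), u ^ i
      = (∑ i ∈ Finset.range (m + 2), u ^ i) * (N * (N : ℝ)⁻¹) := by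
        rw [mul_inv_cancel₀ hN'.ne', mul_one]
    _ = (∑ i ∈ Finset.range (m + 2), u ^ i) * (((√(N : ℝ))⁻¹ ^ m * √(N : ℝ) ^ (m + 2)) *
          ((u - 1) * (u + 1))) := by rw [hu2, this]
    _ = _ := by ring

/-- A Stolz–Cesàro theorem for the weights `√N ^ (m + 2)`. -/
theorem limit_eq_of_increment {F : Type*} [NormedAddCommGroup F] [NormedSpace ℝ F] (m : ℕ)
    {p : ℕ → F} {l L : F}
    (hp : Tendsto (fun N : ℕ => ((√(N : ℝ))⁻¹) ^ (m + 2) • p N) atTop (𝓝 l))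
    (hd : Tendsto (fun N : ℕ => ((√(N : ℝ))⁻¹) ^ m • (p (N + 1) - p N)) atTop (𝓝 L)) :
    ((m + 2 : ℕ) : ℝ) • l = (2 : ℝ) • L := by
  set κ : F := (2 / ((m + 2 : ℕ) : ℝ)) • L with hκ
  have hm : ((m + 2 : ℕ) : ℝ) ≠ 0 := by positivity
  set w : ℕ → ℝ := fun N => √(N : ℝ) ^ (m + 2) with hw
  have hw0 : w 0 = 0 := by simp [hw]
  have hwtop : Tendsto w atTop atTop :=
    (tendsto_pow_atTop (by omega)).comp
      (Real.tendsto_sqrt_atTop.comp tendsto_natCast_atTop_atTop)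
  have hmono : ∀ N, 0 ≤ w (N + 1) - w N := fun N => sub_nonneg.2 <|
    pow_le_pow_left₀ (Real.sqrt_nonneg _) (Real.sqrt_le_sqrt (by push_cast; linarith)) _
  have hinc := tendsto_sqrt_pow_increment m
  -- κ is the predicted limit of p/w. The increments of p - wκ are negligible against those of w,
  -- and summing preserves this because w is monotone and unbounded.
  have ho : (fun N => (p (N + 1) - p N) - (w (N + 1) - w N) • κ) =o[atTop]
      (fun N => w (N + 1) - w N) := by
    have hz : Tendsto (fun N : ℕ => ((√(N : ℝ))⁻¹) ^ m •
        ((p (N + 1) - p N) - (w (N + 1) - w N) • κ)) atTop (𝓝 0) := by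
      have := hd.sub (hinc.smul_const κ)
      rw [hκ, smul_smul, show ((m + 2 : ℕ) : ℝ) / 2 * (2 / ((m + 2 : ℕ) : ℝ)) = 1 by
        field_simp, one_smul, sub_self, ← hκ] at this
      refine this.congr fun N => ?_
      rw [smul_sub _ (p (N + 1) - p N), ← smul_smul]
    have hne : ((m + 2 : ℕ) : ℝ) / 2 ≠ 0 := by positivity
    have hq := (hinc.inv₀ hne).smul hz
    rw [smul_zero] at hq
    have hb := (Asymptotics.isBigO_refl (fun N => w (N + 1) - w N) atTop).smul_isLittleO
      ((Asymptotics.isLittleO_one_iff ℝ).2 hq)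
    refine hb.congr' ?_ (by simp [Filter.EventuallyEq.refl])
    filter_upwards [hinc.eventually_ne hne] with N hN
    change (w (N + 1) - w N) • (((√(N : ℝ))⁻¹) ^ m * (w (N + 1) - w N))⁻¹ • _ = _
    have h1 := left_ne_zero_of_mul hN
    have h2 : w (N + 1) - w N ≠ 0 := right_ne_zero_of_mul hN
    rw [smul_smul, smul_smul]
    generalize ((√(N : ℝ))⁻¹) ^ m = x at h1 ⊢
    rw [mul_inv, mul_comm x⁻¹, ← mul_assoc, mul_inv_cancel₀ h2, one_mul, inv_mul_cancel₀ h1,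
      one_smul]
  have hsum := ho.sum_range hmono (by
    simpa only [Finset.sum_range_sub, hw0, sub_zero] using hwtop)
  have e1 : ∀ N, ∑ i ∈ Finset.range N, ((p (i + 1) - p i) - (w (i + 1) - w i) • κ) =
      p N - p 0 - w N • κ := by
    intro N
    rw [Finset.sum_sub_distrib, Finset.sum_range_sub, ← Finset.sum_smul, Finset.sum_range_sub,
      hw0, sub_zero]
  simp only [e1, Finset.sum_range_sub, hw0, sub_zero] at hsum
  have hlim : Tendsto (fun N => (w N)⁻¹ • (p N - p 0 - w N • κ)) atTop (𝓝 0) :=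
    hsum.tendsto_inv_smul_nhds_zero
  have hlim2 : Tendsto (fun N => (w N)⁻¹ • (p N - p 0 - w N • κ)) atTop (𝓝 (l - κ)) := by
    have h0 : Tendsto (fun N => (w N)⁻¹ • p 0) atTop (𝓝 ((0 : ℝ) • p 0)) :=
      (tendsto_inv_atTop_zero.comp hwtop).smul_const _
    rw [zero_smul] at h0
    have := (hp.sub h0).sub (tendsto_const_nhds (x := κ))
    rw [sub_zero] at this
    refine this.congr' ?_
    filter_upwards [hwtop.eventually_gt_atTop 0] with N hN
    rw [smul_sub, smul_sub, smul_smul, inv_mul_cancel₀ hN.ne', one_smul]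
    simp [hw]
  have : l = κ := sub_eq_zero.1 (tendsto_nhds_unique hlim2 hlim)
  rw [this, hκ, smul_smul]
  congr 1
  field_simp

end ScaledLimits

end PowerSeries

/-! ### From the recursion to the differential equation; sums of convergent series. -/

namespace PowerSeries

open Filter

section

variable {R : Type*} [NormedRing R] [NormedAlgebra ℝ R]

theorem ScaledTendsto.X_mul {g : ℕ → R⟦X⟧} {γ : R⟦X⟧} (hg : ScaledTendsto g γ) :
    ScaledTendsto (fun N => X * g N) 0 := by
  intro n
  cases n with
  | zero => simp
  | succ n =>
    have h := tendsto_inv_sqrt_natCast.smul (hg n)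
    rw [zero_smul] at h
    rw [map_zero]
    refine h.congr fun N => ?_
    rw [coeff_succ_X_mul, smul_smul, pow_succ']

/-- In degree m + 2 the increment is degree m of h plus degree m of z r. The second part vanishes
after scaling, and Stolz–Cesàro yields (m + 2) γ_{m+2} = 2 φ_m. -/
theorem eulerD_eq_of_scaledTendsto {g h r : ℕ → R⟦X⟧} {γ φ ρ : R⟦X⟧}
    (hg : ScaledTendsto g γ) (hh : ScaledTendsto h φ) (hr : ScaledTendsto r ρ)
    (h1 : coeff 1 (g 0) = 0)
    (hstep : ∀ N, g (N + 1) = g N + X ^ 2 * h N + X ^ 3 * r N) :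
    eulerD γ = 2 * X ^ 2 * φ := by
  have e2 : (2 : R⟦X⟧) * X ^ 2 * φ = X ^ 2 * (φ + φ) := by
    rw [mul_assoc, two_mul, mul_add]
  rw [e2]
  ext n
  rw [coeff_eulerD]
  match n with
  | 0 => simp
  -- Stolz–Cesàro starts at degree 2. In degree 1 the recursion adds nothing, so the initial zero
  -- persists.
  | 1 =>
    have hz : ∀ N, coeff 1 (g N) = 0 := by
      intro N
      induction N with
      | zero => exact h1
      | succ N ih => rw [hstep, map_add, map_add, ih, coeff_X_pow_mul', coeff_X_pow_mul']; simp
    have := hg 1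
    simp only [hz, smul_zero] at this
    rw [tendsto_nhds_unique this tendsto_const_nhds, coeff_X_pow_mul']
    simp
  | m + 2 =>
    have hd : Tendsto (fun N : ℕ => ((√(N : ℝ))⁻¹) ^ m •
        (coeff (m + 2) (g (N + 1)) - coeff (m + 2) (g N))) atTop (𝓝 (coeff m φ)) := by
      have := (hh m).add (hr.X_mul m)
      rw [map_zero, add_zero] at this
      refine this.congr fun N => ?_
      rw [hstep, map_add, map_add, add_assoc, add_sub_cancel_left, coeff_X_pow_mul, pow_succ X 2,
        mul_assoc, coeff_X_pow_mul, smul_add]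
    have := limit_eq_of_increment m (hg (m + 2)) hd
    rw [Nat.cast_smul_eq_nsmul] at this
    rw [this, coeff_X_pow_mul, map_add, two_smul]

/-- The power series `f` converges absolutely at `s` with sum `F`. -/
def ConvergesTo (s : ℝ) (f : R⟦X⟧) (F : R) : Prop :=
  (Summable fun n => ‖s ^ n • coeff n f‖) ∧ HasSum (fun n => s ^ n • coeff n f) F

namespace ConvergesTo

variable {s : ℝ}

theorem C (x : R) : ConvergesTo s (PowerSeries.C x) x := by
  have h : ∀ n ≠ 0, s ^ n • coeff n (PowerSeries.C x) = 0 := fun n hn => by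
    rw [coeff_C, if_neg hn, smul_zero]
  refine ⟨(hasSum_single 0 fun n hn => ?_).summable, ?_⟩
  · rw [h n hn, norm_zero]
  · simpa using hasSum_single 0 h

theorem X : ConvergesTo s (PowerSeries.X : R⟦X⟧) (s • 1) := by
  have h : ∀ n ≠ 1, s ^ n • coeff n (PowerSeries.X : R⟦X⟧) = 0 := fun n hn => by
    rw [coeff_X, if_neg hn, smul_zero]
  refine ⟨(hasSum_single 1 fun n hn => ?_).summable, ?_⟩
  · rw [h n hn, norm_zero]
  · simpa using hasSum_single 1 h

variable {f g : R⟦X⟧} {F G : R}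

theorem add (hf : ConvergesTo s f F) (hg : ConvergesTo s g G) : ConvergesTo s (f + g) (F + G) := by
  refine ⟨(hf.1.add hg.1).of_nonneg_of_le (fun _ => norm_nonneg _) fun n => ?_, ?_⟩
  · rw [map_add, smul_add]
    exact norm_add_le _ _
  · simpa only [map_add, smul_add] using hf.2.add hg.2

theorem mul [CompleteSpace R] (hf : ConvergesTo s f F) (hg : ConvergesTo s g G) :
    ConvergesTo s (f * g) (F * G) := by
  have e : ∀ n, s ^ n • coeff n (f * g) = ∑ p ∈ Finset.HasAntidiagonal.antidiagonal n,
      (s ^ p.1 • coeff p.1 f) * (s ^ p.2 • coeff p.2 g) := by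
    intro n
    rw [coeff_mul, Finset.smul_sum]
    refine Finset.sum_congr rfl fun p hp => ?_
    rw [smul_mul_smul_comm, ← pow_add, Finset.HasAntidiagonal.mem_antidiagonal.1 hp]
  have hs := summable_norm_sum_mul_antidiagonal_of_summable_norm hf.1 hg.1
  refine ⟨by simpa only [e] using hs, ?_⟩
  have ht := tsum_mul_tsum_eq_tsum_sum_antidiagonal_of_summable_norm hf.1 hg.1
  rw [hf.2.tsum_eq, hg.2.tsum_eq] at ht
  simp only [e]
  rw [ht]
  exact hs.of_norm.hasSum

theorem unique (hf : ConvergesTo s f F) (hg : ConvergesTo s f G) : F = G := hf.2.unique hg.2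

end ConvergesTo

end

end PowerSeries

/-! ### The central limit equation and analytic continuation to s = 1. -/

namespace CStarProbSpace

open PowerSeries (coeffMap coeff geom ScaledTendsto eulerD ConvergesTo)
open scoped PowerSeries
open Filter

variable {B A : Type*} [CStarAlgebra B] [PartialOrder B] [StarOrderedRing B] [CStarAlgebra A]
  (P : CStarProbSpace B A)

/-- A positive linear map between C*-algebras is bounded; `A` is given its spectral order for this.
-/
theorem exists_norm_E_le : ∃ K : ℝ, ∀ x : A, ‖P.E x‖ ≤ K * ‖x‖ := by
  let _ : PartialOrder A := CStarAlgebra.spectralOrder A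
  have : StarOrderedRing A := CStarAlgebra.spectralOrderedRing A
  obtain ⟨K, hK⟩ := (PositiveLinearMap.mk₀ P.E fun x hx => by
    obtain ⟨y, rfl⟩ := CStarAlgebra.nonneg_iff_eq_star_mul_self.1 hx
    exact P.E_nonneg y).exists_norm_apply_le
  exact ⟨K, hK⟩

/-- The conditional expectation as a continuous real-linear map. -/
noncomputable def ECLM : A →L[ℝ] B :=
  (P.E.restrictScalars ℝ).mkContinuous P.exists_norm_E_le.choose P.exists_norm_E_le.choose_spec

@[simp] theorem ECLM_apply (x : A) : P.ECLM x = P.E x := rfl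

/-- The inclusion as a continuous real-linear map. -/
noncomputable def inclCLM : B →L[ℝ] A :=
  ((P.incl : B →ₐ[ℂ] A).toLinearMap.restrictScalars ℝ).mkContinuous 1 fun b => by
    rw [one_mul]
    exact NonUnitalStarAlgHom.norm_apply_le P.incl b

@[simp] theorem inclCLM_apply (b : B) : P.inclCLM b = P.incl b := rfl

theorem coeff_cauchySeries_C (x : A) (c : B) (n : ℕ) :
    coeff n (P.cauchySeries x (PowerSeries.C c)) =
      P.E (P.incl c * (x * P.incl c) ^ n) := by
  rw [cauchySeries, PowerSeries.coeff_coeffMap, inclSeries_C, PowerSeries.coeff_C_mul_geom]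

theorem law_C_mul_pow (x : A) (c : B) (n : ℕ) :
    P.law x (NCPoly.C c * (NCPoly.X * NCPoly.C c) ^ n) =
      P.E (P.incl c * (x * P.incl c) ^ n) := by
  simp [law, P.eval_X, P.eval_C]

/-- The formal Cauchy transform of the monotone central limit law solves
`z γ' = 2 z² γ a γ a γ`. -/
theorem eulerD_of_centralLimit {X : ℕ → A} {a : B} {μ : NCPoly B →ₗ[ℂ] B}
    (h0 : ∀ i, P.E (X i) = 0) (hlaw : ∀ i k, P.law (X i) = P.law (X k)) (h : P.MonotoneIndep X)
    (hv : ∀ i b, P.E (X i * P.incl b * X i) = a * b * a)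
    (hlim : ∀ f : NCPoly B, Tendsto (fun N : ℕ => P.law (normalizedSum X N) f) atTop (𝓝 (μ f)))
    {c : B} {γ : B⟦X⟧}
    (hγ : ∀ n, coeff n γ = μ (NCPoly.C c * (NCPoly.X * NCPoly.C c) ^ n)) :
    eulerD γ = 2 * PowerSeries.X ^ 2 *
      (γ * PowerSeries.C a * γ * PowerSeries.C a * γ) := by
  set g : ℕ → B⟦X⟧ := fun N => P.cauchySeries (∑ i ∈ Finset.range N, X i) (PowerSeries.C c)
    with hgdef
  have hg : ScaledTendsto g γ := by
    intro n
    rw [hγ]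
    refine (hlim _).congr fun N => ?_
    rw [law_C_mul_pow, hgdef, coeff_cauchySeries_C, normalizedSum, smul_mul_assoc, smul_pow,
      mul_smul_comm, map_smul, ← Complex.ofReal_inv, ← Complex.ofReal_pow, Complex.coe_smul]
  have hi : ScaledTendsto (fun N => P.inclSeries (g N)) (P.inclSeries γ) :=
    hg.map P.inclCLM (by simp) (by simp)
  have hY := (PowerSeries.scaledTendsto_C (X 0)).mul hi
  have hr : ScaledTendsto (fun N => coeffMap P.E (P.inclSeries (g N) *
      (PowerSeries.C (X 0) * P.inclSeries (g N)) ^ 3 *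
        geom (PowerSeries.C (X 0) * P.inclSeries (g N)))) _ :=
    (((hi.mul ((hY.mul hY).mul hY)).mul hY.geom)).map P.ECLM (γ := coeffMap P.E _)
      (fun N n => by simp only [PowerSeries.coeff_coeffMap, ECLM_apply, pow_succ, pow_zero,
        one_mul]) (fun n => by rw [PowerSeries.coeff_coeffMap, ECLM_apply])
  have ha := PowerSeries.scaledTendsto_C a
  refine PowerSeries.eulerD_eq_of_scaledTendsto hg
    ((((hg.mul ha).mul hg).mul ha).mul hg) hr ?_ ?_
  · rw [hgdef]
    simp [cauchySeries_zero]
  · intro N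
    rw [← P.cauchySeries_eq (X 0) a (h0 0) (hv 0)]
    simp only [hgdef, h.cauchySeries_sum_range hlaw, Function.iterate_succ_apply']

/-- An element whose imaginary part is strictly positive and comes from `B` is invertible. -/
theorem isUnit_incl_sub {b : B} (hb : b ∈ operatorUpperHalfPlane B) {x : A}
    (hx : IsSelfAdjoint x) : IsUnit (P.incl b - x) := by
  set k : B := ((ℑ b : selfAdjoint B) : B) with hk
  have hk0 : IsStrictlyPositive k := hb
  -- Conjugation by k^(-1/2) normalizes the imaginary part: r (b - x) r = i - y with y self-adjoint,
  -- and i is not in the spectrum of y.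
  set r : B := k ^ (-(1 / 2) : ℝ) with hr
  have hrk : r * k * r = 1 := CFC.conjugate_rpow_neg_one_half k hk0
  have hrsa : IsSelfAdjoint r := IsSelfAdjoint.of_nonneg CFC.rpow_nonneg
  have hru : IsUnit r := by
    have h1 : IsUnit k := hk0.isUnit
    rw [hr]
    exact (hk0.rpow k _).isUnit
  set y : A := P.incl r * (x - P.incl ((ℜ b : selfAdjoint B) : B)) * P.incl r with hy
  have hysa : IsSelfAdjoint y := by
    have h1 : IsSelfAdjoint (x - P.incl ((ℜ b : selfAdjoint B) : B)) :=
      hx.sub ((ℜ b).2.map P.incl)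
    have h2 : IsSelfAdjoint (P.incl r) := hrsa.map P.incl
    have := h1.conjugate (P.incl r)
    rwa [h2.star_eq] at this
  have hI : IsUnit (algebraMap ℂ A Complex.I - y) := by
    by_contra hcon
    have := hysa.im_eq_zero_of_mem_spectrum (spectrum.mem_iff.2 hcon)
    simp at this
  have e : algebraMap ℂ A Complex.I - y = P.incl r * (P.incl b - x) * P.incl r := by
    have hb' : P.incl b = P.incl ((ℜ b : selfAdjoint B) : B) + Complex.I • P.incl k := by
      rw [← map_smul, ← map_add, hk, realPart_add_I_smul_imaginaryPart]
    have h1 : P.incl r * P.incl k * P.incl r = 1 := by rw [← map_mul, ← map_mul, hrk, map_one]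
    rw [hb', hy, Algebra.algebraMap_eq_smul_one, ← h1]
    simp only [mul_sub, mul_add, sub_mul, add_mul, mul_smul_comm, smul_mul_assoc]
    abel
  rw [e] at hI
  obtain ⟨u, hu⟩ := hru.map P.incl
  rw [← hu, Units.isUnit_mul_units, Units.isUnit_units_mul] at hI
  exact hI

/-- Near `0`, the Cauchy transform `s ↦ E ((b - s x)⁻¹)` is the sum of its moment series. -/
theorem hasEval_E_inverse {b c : B} (hbc : b * c = 1) (hcb : c * b = 1) {x : A} {γ : B⟦X⟧}
    (hγ : ∀ n, coeff n γ = P.E (P.incl c * (x * P.incl c) ^ n)) {s : ℝ}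
    (hs : ‖s • (x * P.incl c)‖ < 1) :
    ConvergesTo s γ (P.E (Ring.inverse (P.incl b - s • x))) := by
  set t : A := s • (x * P.incl c) with ht
  have e : ∀ n, s ^ n • coeff n γ = P.ECLM (P.incl c * t ^ n) := fun n => by
    rw [hγ, ht, smul_pow, mul_smul_comm, map_smul, ECLM_apply]
  have hinv : Ring.inverse (P.incl b - s • x) = P.incl c * Ring.inverse (1 - t) := by
    have hbc' : P.incl b * P.incl c = 1 := by rw [← map_mul, hbc, map_one]
    have hcb' : P.incl c * P.incl b = 1 := by rw [← map_mul, hcb, map_one]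
    obtain ⟨v, hv⟩ := isUnit_one_sub_of_norm_lt_one hs
    have e1 : P.incl b - s • x = (1 - t) * P.incl b := by
      rw [ht, sub_mul, one_mul, smul_mul_assoc, mul_assoc, hcb', mul_one]
    let w : Aˣ := ⟨P.incl b, P.incl c, hbc', hcb'⟩
    rw [e1, ← hv, show (v : A) * P.incl b = ↑(v * w) from rfl, Ring.inverse_unit, Ring.inverse_unit,
      mul_inv_rev, Units.val_mul]
    rfl
  refine ⟨?_, ?_⟩
  · refine Summable.of_nonneg_of_le (fun _ => norm_nonneg _) (fun n => ?_)
      ((summable_norm_geometric_of_norm_lt_one hs).mul_left (‖P.ECLM‖ * ‖P.incl c‖))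
    rw [e, mul_assoc]
    exact (P.ECLM.le_opNorm _).trans
      (mul_le_mul_of_nonneg_left (norm_mul_le _ _) (norm_nonneg _))
  · simp only [e, hinv]
    exact P.ECLM.hasSum ((hasSum_geom_series_inverse t hs).mul_left _)

/-- The identity for the Cauchy transform of a law whose formal Cauchy transform satisfies
`z γ' = 2 z² γ a γ a γ`. -/
theorem sq_mul_cauchyTransform {b c : B} (hb : b ∈ operatorUpperHalfPlane B) (hbc : b * c = 1)
    (hcb : c * b = 1) (a : B) {x : A} (hx : IsSelfAdjoint x) {γ : B⟦X⟧}
    (hγ : ∀ n, coeff n γ = P.E (P.incl c * (x * P.incl c) ^ n))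
    (hD : eulerD γ = 2 * PowerSeries.X ^ 2 *
      (γ * PowerSeries.C a * γ * PowerSeries.C a * γ)) :
    (b * P.E (Ring.inverse (P.incl b - x))) ^ 2 =
      1 + 2 * (a * P.E (Ring.inverse (P.incl b - x))) ^ 2 := by
  set Γ : ℝ → B := fun s => P.E (Ring.inverse (P.incl b - s • x)) with hΓ
  have hγ0 : coeff 0 γ = c := by simp [hγ, P.E_incl]
  have hformal : (PowerSeries.C b * γ) * (PowerSeries.C b * γ) =
      1 + 2 * PowerSeries.X ^ 2 * ((PowerSeries.C a * γ) * (PowerSeries.C a * γ)) := by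
    have hmul : ∀ u : B, eulerD (PowerSeries.C u * γ) = 2 * PowerSeries.X ^ 2 *
        (PowerSeries.C u * γ * (PowerSeries.C a * γ) * (PowerSeries.C a * γ)) := by
      intro u
      rw [PowerSeries.eulerD_mul, PowerSeries.eulerD_C, zero_mul, zero_add, hD, ← mul_assoc,
        two_mul, mul_add, add_mul, add_mul, ← PowerSeries.X_pow_mul]
      simp only [mul_assoc]
    have : IsAddTorsionFree B := .of_isTorsionFree ℂ B
    refine PowerSeries.sq_eq_of_eulerD (hmul b) (hmul a) ?_ ?_
    · rw [PowerSeries.coeff_C_mul, hγ0, hbc]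
    · rw [PowerSeries.coeff_zero_eq_constantCoeff_apply] at hγ0 ⊢
      rw [PowerSeries.coeff_zero_eq_constantCoeff_apply]
      simp only [map_mul, PowerSeries.constantCoeff_C, hγ0, hbc, mul_one, one_mul]
  have hcont : Continuous fun s : ℝ => ‖s • (x * P.incl c)‖ := by fun_prop
  have hnear : ∀ᶠ s : ℝ in 𝓝 0, ‖s • (x * P.incl c)‖ < 1 :=
    (hcont.tendsto 0).eventually_lt_const (by simp)
  -- Near 0 both sides are sums of the same formal series. The 2 is written 1 + 1 to match the
  -- closure rules for `ConvergesTo`.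
  have hloc : (fun s => b * Γ s * (b * Γ s)) =ᶠ[𝓝 0]
      fun s => 1 + (1 + 1) * ((s • (1 : B)) * (s • (1 : B))) * (a * Γ s * (a * Γ s)) := by
    filter_upwards [hnear] with s hs
    have hE := P.hasEval_E_inverse hbc hcb hγ hs
    have h1 := ((ConvergesTo.C b).mul hE).mul ((ConvergesTo.C b).mul hE)
    have hone : ConvergesTo s (1 : B⟦X⟧) 1 := by simpa using ConvergesTo.C (s := s) (1 : B)
    have h2 := hone.add (((hone.add hone).mul (ConvergesTo.X.mul ConvergesTo.X)).mul
      (((ConvergesTo.C a).mul hE).mul ((ConvergesTo.C a).mul hE)))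
    rw [hformal] at h1
    refine h1.unique ?_
    rw [pow_two]
    convert h2 using 4
    norm_num
  have hΓan : AnalyticOnNhd ℝ Γ Set.univ := by
    intro s _
    have hu : IsUnit (P.incl b - s • x) := P.isUnit_incl_sub hb ((IsSelfAdjoint.all s).smul hx)
    obtain ⟨u, hu⟩ := hu
    have h1 : AnalyticAt ℝ (fun s : ℝ => P.incl b - s • x) s :=
      analyticAt_const.sub ((analyticAt_id (𝕜 := ℝ)).smul analyticAt_const)
    have h2 : AnalyticAt ℝ Ring.inverse (P.incl b - s • x) := hu ▸ analyticAt_inverse u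
    exact (P.ECLM.analyticAt _).comp (AnalyticAt.comp (f := fun s : ℝ => P.incl b - s • x) h2 h1)
  have hlin : ∀ u : B, AnalyticOnNhd ℝ (fun s => u * Γ s) Set.univ := fun u =>
    analyticOnNhd_const.mul hΓan
  have hid : AnalyticOnNhd ℝ (fun s : ℝ => s • (1 : B)) Set.univ :=
    analyticOnNhd_id.smul analyticOnNhd_const
  have hglob := congrFun (AnalyticOnNhd.eq_of_eventuallyEq ((hlin b).mul (hlin b))
    (analyticOnNhd_const.add ((analyticOnNhd_const.mul (hid.mul hid)).mul
      ((hlin a).mul (hlin a)))) hloc) 1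
  have hΓ1 : Γ 1 = P.E (Ring.inverse (P.incl b - x)) := by simp [hΓ]
  rw [← hΓ1, pow_two, pow_two]
  refine hglob.trans ?_
  norm_num

end CStarProbSpace

/-! ### The arcsine identities. -/

theorem IsCauchyTransform.sq_eq_of_isArcsineLaw {B : Type u} [CStarAlgebra B]
    [PartialOrder B] [StarOrderedRing B] (a : B) {μ : NCPoly B →ₗ[ℂ] B} {G : B → B}
    (hG : IsCauchyTransform.{u, w} μ G) (hμ : IsArcsineLaw.{u, v} (fun b => a * b * a) μ)
    {b : B} (hb : b ∈ operatorUpperHalfPlane B) :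
    (b * G b) ^ 2 = 1 + 2 * (a * G b) ^ 2 := by
  obtain ⟨A', _, P', x, hx, hlaw, hGb⟩ := hG
  obtain ⟨A, _, P, X, -, h0, hid, hmon, hv, hlim⟩ := hμ
  obtain ⟨u, rfl⟩ : IsUnit b := by
    -- Invertibility of b itself is the case A = B, x = 0 of `isUnit_incl_sub`.
    let Q : CStarProbSpace B B :=
      { incl := StarAlgHom.id ℂ B
        E := LinearMap.id
        E_incl := fun _ => rfl
        E_bimodule := fun _ _ _ => rfl
        E_nonneg := star_mul_self_nonneg }
    simpa [Q] using Q.isUnit_incl_sub hb (IsSelfAdjoint.zero B)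
  rw [hGb _ hb]
  have hγ : ∀ n, PowerSeries.coeff n (PowerSeries.mk fun n =>
      μ (NCPoly.C (↑u⁻¹ : B) * (NCPoly.X * NCPoly.C (↑u⁻¹ : B)) ^ n)) =
      μ (NCPoly.C (↑u⁻¹ : B) * (NCPoly.X * NCPoly.C (↑u⁻¹ : B)) ^ n) := fun n => by simp
  refine P'.sq_mul_cauchyTransform hb u.mul_inv u.inv_mul a hx (fun n => ?_)
    (P.eulerD_of_centralLimit h0 hid hmon hv hlim hγ)
  rw [hγ, ← hlaw, P'.law_C_mul_pow]

theorem mainTheorem6 {B : Type u} [CStarAlgebra B] [PartialOrder B] [StarOrderedRing B]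
    (a : B) (ha : IsSelfAdjoint a) (𝔞 : NCPoly B →ₗ[ℂ] B) (G : B → B)
    (hG : IsCauchyTransform.{u, w} 𝔞 G) :
    (IsArcsineLaw.{u, v} (fun b => a * b * a) 𝔞 →
      ∀ b ∈ operatorUpperHalfPlane B, (b * G b) ^ 2 = 1 + 2 * (a * G b) ^ 2) ∧
    (IsArcsineLaw.{u, v} (fun b => 2 * (a * b * a)) 𝔞 →
      ∀ b ∈ operatorUpperHalfPlane B, (b * G b) ^ 2 = 1 + 4 * (a * G b) ^ 2) := by
  refine ⟨fun h b hb => hG.sq_eq_of_isArcsineLaw a h hb, fun h b hb => ?_⟩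
  have hs : ((√2 : ℝ) : ℂ) * ((√2 : ℝ) : ℂ) = 2 := by
    rw [← Complex.ofReal_mul, Real.mul_self_sqrt zero_le_two, Complex.ofReal_ofNat]
  have h2 : ∀ y : B, (2 : ℂ) • y = 2 * y := fun y => by rw [two_smul, two_mul]
  have hη : (fun b : B => 2 * (a * b * a)) =
      fun b => (((√2 : ℝ) : ℂ) • a) * b * (((√2 : ℝ) : ℂ) • a) := by
    funext b
    rw [smul_mul_assoc, smul_mul_smul_comm, hs, h2]
  rw [hη] at h
  rw [hG.sq_eq_of_isArcsineLaw _ h hb, smul_mul_assoc, smul_pow, pow_two (Complex.ofReal _), hs,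
    h2, ← mul_assoc]
  norm_num
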